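/- **Model.** Items come from an infinite totally ordered set $X$. A randomized comparison-based streaming algorithm has a random seed $\omega$ drawn from an arbitrary probability space, an unrestricted working memory that contains no items, and a finite list of stored stream items, initially empty. When a stream item arrives, the algorithm sees its seed, its working memory and the outcomes of all comparisons among the arriving item and the stored items, and nothing else about the items; depending on these it updates its working memory and chooses which of these items are stored from then on. At the end of a stream $x_1,\dots,x_n$ (whose length is not announced in advance) it receives a query $x\in X$ and outputs a real number $\tilde R(x)$ that depends only on the seed, the working memory and the outcomes of the comparisons among $x$ and the stored items. Let $R(x)=|\{i : x_i\le x\}|$. The algorithm *solves the $\varepsilon$-approximate single quantile problem with probability at least $1-\delta$* if for every finite stream $x_1,\dots,x_n$ in $X$ and every query $x\in X$, $\Pr\big[\,|\tilde R(x)-R(x)|\le\varepsilon n\,\big]\ge 1-\delta$. It *stores at most $s$ elements* if for every finite stream the list of stored items after that stream has length at most $s$ almost surely. **Theorem.** There are universal constants $c,\varepsilon_0,\delta_0>0$ such that for all $0<\varepsilon\le\varepsilon_0$ and $0<\delta\le\delta_0$ the following holds. If a randomized comparison-based algorithm solves the $\varepsilon$-approximate single quantile problem with probability at least $1-\delta$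 and stores at most $s$ elements, then $$ s \;\ge\; c\cdot\frac1\varepsilon\,\log\log\frac1\delta .$$ In other words, such an algorithm must store $\Omega\big((1/\varepsilon)\log\log(1/\delta)\big)$ stream elements. -/

import Mathlib

open MeasureTheory

/-- The outcomes of all pairwise comparisons between the entries of a list of items:
the `(i, j)` entry is `.lt`, `.eq` or `.gt`. -/
def cmpTable {X : Type*} [LinearOrder X] (l : List X) : List (List Ordering) :=
  l.map fun a => l.map fun b => compare a b

/-- A randomized comparison based streaming algorithm with random seed in `Ω` and item-free working
memory in `M`. Besides the working memory the algorithm holds a list of stored stream items.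
The items are opaque: it learns nothing about them except the table of their pairwise comparisons.
The seed may be consulted at any time, and neither the size of `M` nor the computing time is
limited; only stored items are counted. -/
structure RandCmpAlg (Ω M : Type*) where
  /-- The initial working memory (no item is stored at the start). -/
  init : Ω → M
  /-- Called when an item arrives, with the comparison table of the list
  `arriving item :: stored items`. Returns the new working memory and the positions in this list
  of the items that are stored from now on (position `0` is the arriving item). -/
  update : Ω → M → List (List Ordering) → M × List ℕ
  /-- Called when a query is made at the end of the stream, with the comparison table of the list
  `query item :: stored items`. Returns the estimate of the rank of the query item. -/
  answer : Ω → M → List (List Ordering) → ℝ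

namespace RandCmpAlg

variable {Ω M X : Type*} [LinearOrder X]

/-- One step with seed `ω`: from working memory and stored items `s`, on arrival of `x`.
Positions beyond the end of the list select nothing. -/
def next (A : RandCmpAlg Ω M) (ω : Ω) (s : M × List X) (x : X) : M × List X :=
  let r := A.update ω s.1 (cmpTable (x :: s.2))
  (r.1, r.2.filterMap fun i => (x :: s.2)[i]?)

/-- Working memory and stored items after the stream `xs` has been read with seed `ω`. -/
def state (A : RandCmpAlg Ω M) (ω : Ω) (xs : List X) : M × List X :=
  xs.foldl (A.next ω) (A.init ω, [])

/-- The items stored after the stream `xs` has been read with seed `ω`. -/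
def stored (A : RandCmpAlg Ω M) (ω : Ω) (xs : List X) : List X :=
  (A.state ω xs).2

/-- The estimate for the rank of the query `x` after the stream `xs` has been read with
seed `ω`. -/
def estimate (A : RandCmpAlg Ω M) (ω : Ω) (xs : List X) (x : X) : ℝ :=
  A.answer ω (A.state ω xs).1 (cmpTable (x :: A.stored ω xs))

end RandCmpAlg

/-- The rank of `x` in the stream `xs`: the number of stream items that are at most `x`. -/
def streamRank {X : Type*} [LinearOrder X] (xs : List X) (x : X) : ℕ :=
  xs.countP fun y => decide (y ≤ x)

/-- `A` solves the `ε`-approximate single quantile problem over the ordered universe `X` with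
probability at least `1 - δ`: for every stream and every query, the probability that the
estimate is off by more than `ε` times the length of the stream is at most `δ`.
(For a set that is not measurable, `P` is the outer measure.) -/
def SolvesSingleQuantile {Ω M : Type*} [MeasurableSpace Ω] (P : Measure Ω)
    (X : Type*) [LinearOrder X] (A : RandCmpAlg Ω M) (ε δ : ℝ) : Prop :=
  ∀ (xs : List X) (x : X),
    P {ω | ε * (xs.length : ℝ) < |A.estimate ω xs x - (streamRank xs x : ℝ)|} ≤ ENNReal.ofReal δ

/-- `A` stores at most `s` stream items: after every stream (hence also at every earlier moment)
the list of stored items has length at most `s`, almost surely. -/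
def StoresAtMost {Ω M : Type*} [MeasurableSpace Ω] (P : Measure Ω)
    (X : Type*) [LinearOrder X] (A : RandCmpAlg Ω M) (s : ℕ) : Prop :=
  ∀ xs : List X, ∀ᵐ ω ∂P, (A.stored ω xs).length ≤ s

/-! Fix a seed, so that the algorithm is deterministic, and zoom into the order: every new item is
put into the empty grid cell just after a current location. Two pairs (stream, location) whose
comparisons with the stored items agree get the same answer, so the largest rank difference between
them, `gap`, is at most twice the allowed error (`Alt.le_of_blockCorrect`).

The zooming is recursive: a first half of `2 ^ j` insertions ends at a location `a₁`, and a second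
half of `2 ^ j` insertions goes into the cell after `a₁`. Suppose no item of the first half is
stored at the end. Then the new stored items only tell first-half locations up to `a₁` from those
beyond `a₁`. Within each of these two classes locations can be exchanged unnoticed, so the
uncertainty of a uniformly random first-half location has grown by about `2 ^ j / 4` (`Alt.extend`,
`stored_or_uncertain`). Otherwise some item has been kept during the whole second half, which costs
`2 ^ j` units of storage times time. The process finishes at a random first-half location with
probability `1 / (j + 1)` and where the second half finished otherwise. With weight `4 * j` on the
uncertainty, each split then gains `2 ^ j - 1` (`zoomMean_cost_add_gap_ge`). For `n = 2 ^ k` rounds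
the total is about `n * k / 2`, so small uncertainty forces average storage of order `k`.

The process does not look at the algorithm, so one random history can be fed to about `1 / (32 * ε)`
order-separated blocks in parallel. The error allowed on the whole stream is then at most `n / 32`,
while the storage of the blocks adds up (`storage_ge_of_blockCorrect`). The seed comes from a union
bound over the `2 ^ (2 * n ^ 2 + n)` grid configurations of a block, affordable for `k` of order
`log log (1 / δ)`: each block fails with probability at most `1 / 4`, so some seed is correct on
half of the blocks. -/

namespace ZoomGame

/-! ### Indistinguishable streams and rank uncertainty -/

/-- The offset list `τ` has the same length as `h`, and each arriving entry compares in the same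
strict way with the entries that are stored (according to `S`) at that moment. -/
def Shadow (S : List ℕ → Finset ℕ) (h τ : List ℕ) : Prop :=
  τ.length = h.length ∧ ∀ t < h.length, ∀ r ∈ S (h.take t),
    (h.getD r 0 < h.getD t 0 ∧ τ.getD r 0 < τ.getD t 0) ∨
    (h.getD t 0 < h.getD r 0 ∧ τ.getD t 0 < τ.getD r 0)

/-- `x` lies on the grid of mesh `2 ^ (n - l)` in `[0, 2 ^ n)`. -/
def OnGrid (n l x : ℕ) : Prop := 2 ^ (n - l) ∣ x ∧ x < 2 ^ n

/-- The number of entries of `h` that are at most `a`. -/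
def offsetRank (h : List ℕ) (a : ℕ) : ℕ := h.countP fun x => decide (x ≤ a)

/-- Some stream indistinguishable from `h` has a location `b` indistinguishable from `a` whose
rank exceeds that of `a` by `d`. -/
def Alt (n : ℕ) (S : List ℕ → Finset ℕ) (h : List ℕ) (a d : ℕ) : Prop :=
  ∃ (τ : List ℕ) (b : ℕ), Shadow S h τ ∧ (∀ x ∈ τ, OnGrid n h.length x) ∧ OnGrid n h.length b ∧
    (∀ r ∈ S h, h.getD r 0 ≤ a ↔ τ.getD r 0 ≤ b) ∧ offsetRank τ b = offsetRank h a + d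

/-- The rank uncertainty at the location `a`. -/
noncomputable def gap (n : ℕ) (S : List ℕ → Finset ℕ) (h : List ℕ) (a : ℕ) : ℕ :=
  sSup {d | Alt n S h a d}

/-- `h` is a list of grid points and `a` is a grid point. -/
def Context (n : ℕ) (h : List ℕ) (a : ℕ) : Prop :=
  h.length ≤ n ∧ (∀ x ∈ h, OnGrid n h.length x) ∧ OnGrid n h.length a

/-- The entries of `V` are distinct and lie immediately after `a` in a stream starting with `h`. -/
def Fits (n : ℕ) (h : List ℕ) (a : ℕ) (V : List ℕ) : Prop :=
  (h ++ V).length ≤ n ∧ V.Nodup ∧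
    ∀ x ∈ V, a < x ∧ x < a + 2 ^ (n - h.length) ∧ 2 ^ (n - (h ++ V).length) ∣ x

/-- Each stored round was either stored before or has just arrived. -/
def Shrinking (S : List ℕ → Finset ℕ) : Prop :=
  S [] = ∅ ∧ ∀ h x, S (h ++ [x]) ⊆ insert h.length (S h)

variable {n : ℕ} {S : List ℕ → Finset ℕ} {h : List ℕ} {a d : ℕ} {V : List ℕ}

lemma Shrinking.lt_length (hS : Shrinking S) : ∀ h, ∀ r ∈ S h, r < h.length := by
  intro h
  induction h using List.reverseRecOn with
  | nil => simp [hS.1]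
  | append_singleton h x ih =>
    intro r hr
    have := hS.2 h x hr
    rw [Finset.mem_insert] at this
    rcases this with rfl | h1
    · simp
    · have := ih r h1
      simp; omega

/-- A discarded item never returns, because a round can enter the stored set only on arrival. -/
lemma Shrinking.mem_of_append (hS : Shrinking S) (h V : List ℕ) :
    ∀ r ∈ S (h ++ V), r < h.length → r ∈ S h := by
  induction V using List.reverseRecOn with
  | nil => simpa using fun r hr _ => hr
  | append_singleton V x ih =>
    intro r hr hlt
    rw [← List.append_assoc] at hr
    have := hS.2 _ x hr
    rw [Finset.mem_insert] at this
    rcases this with rfl | h1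
    · simp at hlt
    · exact ih r h1 hlt

/-- Grid cells have no grid points inside. This keeps old entries from separating the points of the
cell into which new entries are placed. -/
lemma le_or_add_le_of_dvd {e x a : ℕ} (hx : e ∣ x) (ha : e ∣ a) : x ≤ a ∨ a + e ≤ x := by
  obtain ⟨c, rfl⟩ := hx
  obtain ⟨d, rfl⟩ := ha
  rcases Nat.lt_or_ge d c with h | h
  · right; calc e * d + e = e * (d + 1) := by ring
      _ ≤ e * c := Nat.mul_le_mul_left _ h
  · left; exact Nat.mul_le_mul_left _ h

lemma offsetRank_append (h V : List ℕ) (a : ℕ) :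
    offsetRank (h ++ V) a = offsetRank h a + offsetRank V a := by
  simp [offsetRank]

lemma offsetRank_eq_of_grid {e b c : ℕ} {τ : List ℕ} (hτ : ∀ x ∈ τ, e ∣ x) (hb : e ∣ b)
    (hbc : b ≤ c) (hc : c < b + e) : offsetRank τ c = offsetRank τ b := by
  unfold offsetRank
  apply List.countP_congr
  intro x hx
  rcases le_or_add_le_of_dvd (hτ x hx) hb with h | h <;> simp <;> omega

lemma alt_nil (hS : Shrinking S) : Alt n S [] 0 0 :=
  ⟨[], 0, ⟨rfl, by simp⟩, by simp, ⟨dvd_zero _, by positivity⟩, by simp [hS.1], rfl⟩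

/-- Bounds the set in `gap`, so that its `sSup` is an attained maximum and not the default value
`0`. -/
lemma Alt.le_length (hd : Alt n S h a d) : d ≤ h.length := by
  obtain ⟨τ, b, hsh, -, -, -, hr⟩ := hd
  have : offsetRank τ b ≤ τ.length := List.countP_le_length
  have := hsh.1
  omega

lemma Alt.le_gap (hd : Alt n S h a d) : d ≤ gap n S h a :=
  le_csSup ⟨h.length, fun _ hx => Alt.le_length hx⟩ hd

lemma alt_gap (hd : Alt n S h a d) : Alt n S h a (gap n S h a) :=
  Nat.sSup_mem ⟨d, hd⟩ ⟨h.length, fun _ hx => Alt.le_length hx⟩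

lemma offsetRank_le_add (V : List ℕ) {z z' : ℕ} (hz : z ≤ z') :
    offsetRank V z' = offsetRank V z + V.countP fun x => decide (z < x ∧ x ≤ z') := by
  unfold offsetRank
  induction V with
  | nil => simp
  | cons x V ih =>
    simp only [List.countP_cons, ih]
    by_cases h1 : x ≤ z <;> by_cases h2 : x ≤ z' <;> simp [h1, h2, not_lt.2, lt_of_not_ge] <;> omega

lemma pow_dvd_of_le {l l' x : ℕ} (h : l ≤ l') (hx : 2 ^ (n - l) ∣ x) : 2 ^ (n - l') ∣ x :=
  (pow_dvd_pow 2 (by omega)).trans hx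

/-- Copying the new entries `V` to the location `b` of an indistinguishable stream, and moving the
location from `z` to `z'` unnoticed. -/
lemma Alt.extend (hS : Shrinking S) (hc : Context n h a) (hV : Fits n h a V)
    (hd : Alt n S h a d) {z z' : ℕ} (hz : z ∈ a :: V) (hz' : z' ∈ a :: V) (hzz : z ≤ z')
    (hst : ∀ r ∈ S (h ++ V), h.length ≤ r →
      ((h ++ V).getD r 0 ≤ z ↔ (h ++ V).getD r 0 ≤ z')) :
    Alt n S (h ++ V) z (d + V.countP fun x => decide (z < x ∧ x ≤ z')) := by
  obtain ⟨τ, b, hsh, hτ, hb, hloc, hr⟩ := hd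
  obtain ⟨hlen, hnd, hVx⟩ := hV
  obtain ⟨-, hgrid, ha⟩ := hc
  set e := 2 ^ (n - h.length) with he
  have hepos : 0 < e := by positivity
  have hle : h.length ≤ (h ++ V).length := by simp
  have hbe : b + e ≤ 2 ^ n := by
    have hen : e ∣ 2 ^ n := pow_dvd_pow 2 (Nat.sub_le _ _)
    rcases le_or_add_le_of_dvd hen hb.1 with h1 | h1
    · have := hb.2; omega
    · exact h1
  have haV : ∀ x ∈ a :: V, a ≤ x ∧ x < a + e ∧ 2 ^ (n - (h ++ V).length) ∣ x := by
    intro x hx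
    rcases List.mem_cons.1 hx with rfl | hx
    · exact ⟨le_rfl, by omega, pow_dvd_of_le hle ha.1⟩
    · exact ⟨(hVx x hx).1.le, (hVx x hx).2⟩
  have hshift : ∀ x ∈ a :: V, OnGrid n (h ++ V).length (x - a + b) := by
    intro x hx
    obtain ⟨h1, h2, h3⟩ := haV x hx
    exact ⟨dvd_add (Nat.dvd_sub h3 (pow_dvd_of_le hle ha.1)) (pow_dvd_of_le hle hb.1), by omega⟩
  have old1 : ∀ r, r < h.length → (h ++ V).getD r 0 = h.getD r 0 := fun r hr =>
    List.getD_append _ _ _ _ hr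
  have old2 : ∀ r, r < h.length → (τ ++ V.map fun x => x - a + b).getD r 0 = τ.getD r 0 :=
    fun r hr => List.getD_append _ _ _ _ (hsh.1 ▸ hr)
  have new : ∀ r, h.length ≤ r → r < (h ++ V).length → ∃ y ∈ V, (h ++ V).getD r 0 = y ∧
      (τ ++ V.map fun x => x - a + b).getD r 0 = y - a + b ∧ V[r - h.length]? = some y := by
    intro r hr hr'
    have hlt : r - h.length < V.length := by simp at hr'; omega
    refine ⟨V[r - h.length], List.getElem_mem _, ?_, ?_, by simp [hlt]⟩
    · rw [List.getD_append_right _ _ _ _ hr]; simp [hlt]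
    · rw [List.getD_append_right _ _ _ _ (hsh.1.le.trans hr), hsh.1,
        List.getD_eq_getElem _ _ (by simpa using hlt)]
      simp
  have mem_h : ∀ r, r < h.length → 2 ^ (n - h.length) ∣ h.getD r 0 := by
    intro r hr
    rw [List.getD_eq_getElem _ _ hr]
    exact (hgrid _ (List.getElem_mem _)).1
  have mem_τ : ∀ r, r < h.length → 2 ^ (n - h.length) ∣ τ.getD r 0 := by
    intro r hr
    rw [List.getD_eq_getElem _ _ (hsh.1 ▸ hr)]
    exact (hτ _ (List.getElem_mem _)).1
  -- The cells after `a` and after `b` contain no old entries, so a stored old entry lies on the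
  -- same side of the whole cell in both streams.
  have old_new : ∀ r ∈ S h, ∀ y ∈ a :: V,
      (h.getD r 0 ≤ a ∧ τ.getD r 0 ≤ b) ∨
      (y < h.getD r 0 ∧ y - a + b < τ.getD r 0) := by
    intro r hr y hy
    have hlt := hS.lt_length h r hr
    obtain ⟨h1, h2, -⟩ := haV y hy
    have hiff := hloc r hr
    rcases le_or_add_le_of_dvd (mem_h r hlt) ha.1 with h3 | h3
    · exact Or.inl ⟨h3, hiff.1 h3⟩
    · rcases le_or_add_le_of_dvd (mem_τ r hlt) hb.1 with h4 | h4
      · have := hiff.2 h4; omega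
      · right; constructor <;> omega
  -- The witness translates `V` from the cell after `a` to the cell after `b`, and takes the
  -- translate of `z'`, not of `z`, as its location. The stored new entries do not separate the two,
  -- and the rank grows by the entries in between.
  refine ⟨τ ++ V.map fun x => x - a + b, z' - a + b, ⟨by simp [hsh.1], ?_⟩, ?_,
    hshift z' hz', ?_, ?_⟩
  · intro t ht r hrt
    have hrlt : r < t := by
      have := hS.lt_length _ r hrt
      simp at this; omega
    rcases Nat.lt_or_ge t h.length with h1 | h1
    · rw [List.take_append_of_le_length h1.le] at hrt
      rw [old1 t h1, old2 t h1, old1 r (by omega), old2 r (by omega)]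
      exact hsh.2 t h1 r hrt
    · obtain ⟨y, hy, e1, e2, e3⟩ := new t h1 ht
      rw [e1, e2]
      obtain ⟨ya, -⟩ := hVx y hy
      rcases Nat.lt_or_ge r h.length with h2 | h2
      · rw [List.take_append, List.take_of_length_le h1] at hrt
        have hrS := hS.mem_of_append _ _ r hrt h2
        rw [old1 r h2, old2 r h2]
        rcases old_new r hrS y (List.mem_cons_of_mem _ hy) with h3 | h3
        · left; omega
        · right; exact h3
      · obtain ⟨y', hy', f1, f2, f3⟩ := new r h2 (by omega)
        rw [f1, f2]
        obtain ⟨ya', -⟩ := hVx y' hy'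
        have : y' ≠ y := by
          rintro rfl
          have := hnd.getElem_inj_iff (i := r - h.length) (j := t - h.length)
            (hi := (List.getElem?_eq_some_iff.1 f3).1) (hj := (List.getElem?_eq_some_iff.1 e3).1)
          rw [(List.getElem?_eq_some_iff.1 f3).2, (List.getElem?_eq_some_iff.1 e3).2] at this
          have := this.1 rfl
          omega
        omega
  · intro x hx
    rcases List.mem_append.1 hx with hx | hx
    · exact ⟨pow_dvd_of_le hle (hτ x hx).1, (hτ x hx).2⟩
    · obtain ⟨y, hy, rfl⟩ := List.mem_map.1 hx
      exact hshift y (List.mem_cons_of_mem _ hy)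
  · intro r hrS
    have hrlt := hS.lt_length _ r hrS
    rcases Nat.lt_or_ge r h.length with h1 | h1
    · rw [old1 r h1, old2 r h1]
      have hrS' := hS.mem_of_append _ _ r hrS h1
      have za := (haV z hz).1
      have za' := (haV z' hz').1
      rcases old_new r hrS' z' hz' with h3 | h3 <;> constructor <;> omega
    · obtain ⟨y, hy, e1, e2, -⟩ := new r h1 hrlt
      have := hst r hrS h1
      rw [e1] at this
      rw [e1, e2, this]
      have := (hVx y hy).1
      have := (haV z' hz').1
      omega
  · rw [offsetRank_append, offsetRank_append]
    obtain ⟨z1, z2, -⟩ := haV z hz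
    obtain ⟨z1', z2', -⟩ := haV z' hz'
    rw [offsetRank_eq_of_grid (fun x hx => (hτ x hx).1) hb.1 (by omega) (by omega), hr,
      offsetRank_eq_of_grid (fun x hx => (hgrid x hx).1) ha.1 z1 z2]
    have : offsetRank (V.map fun x => x - a + b) (z' - a + b) = offsetRank V z' := by
      unfold offsetRank
      rw [List.countP_map]
      apply List.countP_congr
      intro x hx
      have := (hVx x hx).1
      simp; omega
    rw [this, offsetRank_le_add V hzz]
    ring

end ZoomGame

/-! ### Counting over indistinguishable locations -/

namespace ZoomGame

variable {n : ℕ} {S : List ℕ → Finset ℕ} {h : List ℕ} {a d : ℕ} {V : List ℕ}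

/-- Counts each pair of elements once, at its smaller member. -/
lemma two_mul_sum_card_filter_lt (L : Finset ℕ) :
    2 * ∑ z ∈ L, ((L.filter fun x => z < x).card : ℝ) = (L.card : ℝ) ^ 2 - L.card := by
  induction L using Finset.induction_on_max with
  | empty => simp
  | insert m L hm ih =>
    have hmL : m ∉ L := fun hx => (hm m hx).false
    rw [Finset.sum_insert hmL, Finset.card_insert_of_notMem hmL]
    have h1 : (insert m L).filter (fun x => m < x) = ∅ := by
      apply Finset.filter_eq_empty_iff.2
      intro x hx
      rcases Finset.mem_insert.1 hx with rfl | hx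
      · simp
      · exact (hm x hx).not_gt
    have h2 : ∀ z ∈ L, (((insert m L).filter fun x => z < x).card : ℝ) =
        (L.filter fun x => z < x).card + 1 := by
      intro z hz
      rw [Finset.filter_insert, if_pos (hm z hz), Finset.card_insert_of_notMem (by simp [hmL])]
      push_cast; ring
    rw [h1, Finset.sum_congr rfl h2, Finset.sum_add_distrib, mul_add, mul_add, ih]
    simp
    ring

lemma Fits.grid_le (hc : Context n h a) (hV : Fits n h a V) :
    ∀ x ∈ a :: V, a ≤ x ∧ x + 2 ^ (n - (h ++ V).length) ≤ a + 2 ^ (n - h.length) ∧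
      2 ^ (n - (h ++ V).length) ∣ x := by
  have hle : h.length ≤ (h ++ V).length := by simp
  have ha := pow_dvd_of_le hle hc.2.2.1
  have hpow : 2 ^ (n - (h ++ V).length) ∣ 2 ^ (n - h.length) := pow_dvd_pow 2 (by omega)
  have hpos : 0 < 2 ^ (n - h.length) := by positivity
  intro x hx
  have hx' : a ≤ x ∧ x < a + 2 ^ (n - h.length) ∧ 2 ^ (n - (h ++ V).length) ∣ x := by
    rcases List.mem_cons.1 hx with rfl | hx
    · exact ⟨le_rfl, by omega, ha⟩
    · exact ⟨(hV.2.2 x hx).1.le, (hV.2.2 x hx).2⟩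
  refine ⟨hx'.1, ?_, hx'.2.2⟩
  rcases le_or_add_le_of_dvd (dvd_add ha hpow) hx'.2.2 with h1 | h1 <;> omega

lemma Fits.context (hc : Context n h a) (hV : Fits n h a V) {b : ℕ} (hb : b ∈ a :: V) :
    Context n (h ++ V) b := by
  have hle : h.length ≤ (h ++ V).length := by simp
  have haen : a + 2 ^ (n - h.length) ≤ 2 ^ n := by
    have hen : 2 ^ (n - h.length) ∣ 2 ^ n := pow_dvd_pow 2 (Nat.sub_le _ _)
    rcases le_or_add_le_of_dvd hen hc.2.2.1 with h1 | h1
    · have := hc.2.2.2; omega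
    · exact h1
  have hpos : 0 < 2 ^ (n - (h ++ V).length) := by positivity
  have key : ∀ x ∈ a :: V, OnGrid n (h ++ V).length x := fun x hx => by
    obtain ⟨-, h2, h3⟩ := hV.grid_le hc x hx
    exact ⟨h3, by omega⟩
  refine ⟨hV.1, ?_, key b hb⟩
  intro x hx
  rcases List.mem_append.1 hx with hx | hx
  · exact ⟨pow_dvd_of_le hle (hc.2.1 x hx).1, (hc.2.1 x hx).2⟩
  · exact key x (List.mem_cons_of_mem _ hx)

/-- The second batch lies in a cell of the finer grid on which `V₁` already lives, so it stays
inside the cell after `a` and misses `V₁`. -/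
lemma Fits.append (hc : Context n h a) {V₁ V₂ : List ℕ} (h₁ : Fits n h a V₁) {a₁ : ℕ}
    (ha₁ : a₁ ∈ a :: V₁) (h₂ : Fits n (h ++ V₁) a₁ V₂) : Fits n h a (V₁ ++ V₂) := by
  have hg := h₁.grid_le hc
  have ha1 := hg a₁ ha₁
  refine ⟨by simpa using h₂.1, ?_, ?_⟩
  · refine List.Nodup.append h₁.2.1 h₂.2.1 ?_
    intro x hx1 hx2
    obtain ⟨h3, h4, -⟩ := h₂.2.2 x hx2
    rcases le_or_add_le_of_dvd (hg x (List.mem_cons_of_mem _ hx1)).2.2 ha1.2.2 with h5 | h5 <;>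
      omega
  · intro x hx
    rw [← List.append_assoc]
    rcases List.mem_append.1 hx with hx | hx
    · exact ⟨(h₁.2.2 x hx).1, (h₁.2.2 x hx).2.1, pow_dvd_of_le (by simp) (h₁.2.2 x hx).2.2⟩
    · obtain ⟨h3, h4, h5⟩ := h₂.2.2 x hx
      exact ⟨by omega, by omega, h5⟩

/-- The case without a hidden move: zooming further never destroys uncertainty already gained. -/
lemma Alt.extend_self (hS : Shrinking S) (hc : Context n h a) (hV : Fits n h a V)
    (hd : Alt n S h a d) {z : ℕ} (hz : z ∈ a :: V) : Alt n S (h ++ V) z d := by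
  have h1 := hd.extend hS hc hV hz hz le_rfl (fun _ _ _ => Iff.rfl)
  have h2 : (V.countP fun x => decide (z < x ∧ x ≤ z)) = 0 := by
    rw [List.countP_eq_zero]
    intro x _
    simp
  rwa [h2, add_zero] at h1

/-- If the locations in `L` cannot be told apart, then their average uncertainty is large. -/
lemma two_mul_sum_gap_ge (hS : Shrinking S) (hc : Context n h a) (hV : Fits n h a V)
    (hd : Alt n S h a d) (L : Finset ℕ) (hL : ∀ z ∈ L, z ∈ a :: V)
    (hst : ∀ z ∈ L, ∀ z' ∈ L, ∀ r ∈ S (h ++ V), h.length ≤ r →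
      ((h ++ V).getD r 0 ≤ z ↔ (h ++ V).getD r 0 ≤ z')) :
    2 * ((L.card : ℝ) * d) + ((L.card : ℝ) ^ 2 - L.card) ≤
      2 * ∑ z ∈ L, (gap n S (h ++ V) z : ℝ) := by
  rcases L.eq_empty_or_nonempty with rfl | hne
  · simp
  rw [← two_mul_sum_card_filter_lt, ← mul_add, ← nsmul_eq_mul, ← Finset.sum_const,
    ← Finset.sum_add_distrib]
  gcongr with z hz
  -- Moving unnoticed from `z` to the largest location skips every element of `L` above `z`.
  set m := L.max' hne
  have hm : m ∈ L := L.max'_mem hne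
  have h1 := (hd.extend hS hc hV (hL z hz) (hL m hm) (L.le_max' z hz) (hst z hz m hm)).le_gap
  have h2 : (L.filter fun x => z < x).card ≤ V.countP fun x => decide (z < x ∧ x ≤ m) := by
    rw [List.countP_eq_length_filter]
    refine le_trans (Finset.card_le_card ?_) (List.toFinset_card_le _)
    intro x hx
    rw [Finset.mem_filter] at hx
    have h3 := hL x hx.1
    have h4 : a ≤ z := (hV.grid_le hc z (hL z hz)).1
    have h5 := L.le_max' x hx.1
    rw [List.mem_toFinset, List.mem_filter]
    rcases List.mem_cons.1 h3 with rfl | h3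
    · omega
    · exact ⟨h3, by simpa using ⟨hx.2, h5⟩⟩
  exact_mod_cast (by omega : d + (L.filter fun x => z < x).card ≤ gap n S (h ++ V) z)

/-- The number of rounds in `[s, e)` that are stored after `h`. -/
def storedIn (S : List ℕ → Finset ℕ) (s e : ℕ) (h : List ℕ) : ℕ :=
  ((S h).filter fun r => s ≤ r ∧ r < e).card

lemma Fits.card_locations (hV : Fits n h a V) : (a :: V).toFinset.card = V.length + 1 := by
  rw [List.toFinset_card_of_nodup]
  · simp
  · exact List.nodup_cons.2 ⟨fun hx => (hV.2.2 a hx).1.false, hV.2.1⟩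

/-- Either an entry of the first half is still stored after the second half, or the average
uncertainty of the locations of the first half is large. -/
lemma stored_or_uncertain (hS : Shrinking S) (hc : Context n h a) {V₁ V₂ : List ℕ}
    (h₁ : Fits n h a V₁) {a₁ : ℕ} (ha₁ : a₁ ∈ a :: V₁) (h₂ : Fits n (h ++ V₁) a₁ V₂)
    (hd : Alt n S h a d) :
    (V₁.length : ℝ) - 1 + 4 * d ≤
      V₁.length * storedIn S h.length (h.length + V₁.length) (h ++ V₁ ++ V₂) +
      4 * ((∑ z ∈ (a :: V₁).toFinset, (gap n S (h ++ V₁ ++ V₂) z : ℝ)) /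
        (a :: V₁).toFinset.card) := by
  have hcard := h₁.card_locations
  have hV := h₁.append hc ha₁ h₂
  have hmem : ∀ z ∈ (a :: V₁).toFinset, z ∈ a :: (V₁ ++ V₂) := by
    intro z hz
    rw [List.mem_toFinset] at hz
    simp only [List.mem_cons, List.mem_append] at hz ⊢
    tauto
  obtain ⟨N, hN⟩ : ∃ N : ℝ, N = V₁.length := ⟨_, rfl⟩
  rw [← hN]
  have hcardR : ((a :: V₁).toFinset.card : ℝ) = N + 1 := by rw [hcard, hN]; push_cast; rfl
  have hN0 : 0 ≤ N := by rw [hN]; positivity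
  rw [hcardR, List.append_assoc]
  rcases Nat.eq_zero_or_pos (storedIn S h.length (h.length + V₁.length) (h ++ (V₁ ++ V₂)))
    with h0 | hpos
  · rw [h0]
    -- All of `V₂` lies in the cell just after `a₁`, above every location up to `a₁` and below every
    -- later one. Hence neither class is split by a stored new entry.
    set L₁ := (a :: V₁).toFinset.filter fun z => z ≤ a₁ with hL₁
    set L₂ := (a :: V₁).toFinset.filter fun z => ¬ z ≤ a₁ with hL₂
    have hnew : ∀ r ∈ S (h ++ (V₁ ++ V₂)), h.length ≤ r → ∀ z ∈ a :: V₁,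
        ((h ++ (V₁ ++ V₂)).getD r 0 ≤ z ↔ ¬ z ≤ a₁) := by
      intro r hr hle z hz
      have hlt := hS.lt_length _ r hr
      have hge : (h ++ V₁).length ≤ r := by
        by_contra hcon
        rw [storedIn, Finset.card_eq_zero, Finset.filter_eq_empty_iff] at h0
        exact h0 hr ⟨hle, by simpa using hcon⟩
      rw [← List.append_assoc] at hlt ⊢
      have hlt' : r - (h ++ V₁).length < V₂.length := by
        rw [List.length_append (bs := V₂)] at hlt; omega
      rw [List.getD_append_right _ _ _ _ hge, List.getD_eq_getElem _ _ hlt']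
      obtain ⟨h3, h4, -⟩ := h₂.2.2 _ (List.getElem_mem hlt')
      rcases le_or_add_le_of_dvd (h₁.grid_le hc z hz).2.2 (h₁.grid_le hc a₁ ha₁).2.2
        with h5 | h5 <;> omega
    have b₁ := two_mul_sum_gap_ge hS hc hV hd L₁ (fun z hz => hmem z (Finset.mem_filter.1 hz).1)
      (by
        intro z hz z' hz' r hr hle
        rw [Finset.mem_filter, List.mem_toFinset] at hz hz'
        rw [hnew r hr hle z hz.1, hnew r hr hle z' hz'.1]
        tauto)
    have b₂ := two_mul_sum_gap_ge hS hc hV hd L₂ (fun z hz => hmem z (Finset.mem_filter.1 hz).1)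
      (by
        intro z hz z' hz' r hr hle
        rw [Finset.mem_filter, List.mem_toFinset] at hz hz'
        rw [hnew r hr hle z hz.1, hnew r hr hle z' hz'.1]
        tauto)
    have hc12 : (L₁.card : ℝ) + L₂.card = N + 1 := by
      rw [← hcardR]
      exact_mod_cast Finset.card_filter_add_card_filter_not (s := (a :: V₁).toFinset)
        (fun z => z ≤ a₁)
    have hsum := Finset.sum_filter_add_sum_filter_not (a :: V₁).toFinset (fun z => z ≤ a₁)
      (fun z => (gap n S (h ++ (V₁ ++ V₂)) z : ℝ))
    rw [← hsum]
    have hdiv : (N - 1 + 4 * d) / 4 ≤ (∑ z ∈ L₁, (gap n S (h ++ (V₁ ++ V₂)) z : ℝ) +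
        ∑ z ∈ L₂, (gap n S (h ++ (V₁ ++ V₂)) z : ℝ)) / (N + 1) := by
      rw [le_div_iff₀ (by positivity)]
      have hq : (L₂.card : ℝ) = N + 1 - L₁.card := by linarith
      rw [hq] at b₂
      -- The worst case is two classes of equal size: `p ^ 2 + q ^ 2 ≥ (p + q) ^ 2 / 2`.
      nlinarith [sq_nonneg (2 * (L₁.card : ℝ) - (N + 1))]
    push_cast
    linarith
  -- One surviving entry already contributes `N`, so it suffices that the average uncertainty has
  -- not dropped below `d`.
  · have h3 : (d : ℝ) ≤ (∑ z ∈ (a :: V₁).toFinset, (gap n S (h ++ (V₁ ++ V₂)) z : ℝ)) /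
        (N + 1) := by
      rw [le_div_iff₀ (by positivity), ← hcardR, mul_comm, ← nsmul_eq_mul, ← Finset.sum_const]
      apply Finset.sum_le_sum
      intro z hz
      exact_mod_cast (hd.extend_self hS hc hV (hmem z hz)).le_gap
    have h4 : (1 : ℝ) ≤ storedIn S h.length (h.length + V₁.length) (h ++ (V₁ ++ V₂)) := by
      exact_mod_cast hpos
    nlinarith

/-! ### The random zooming process and its storage-uncertainty trade-off -/

/-- The mean of `f` over the random zooming process with `2 ^ j` insertions that starts from the
history `h` at the location `a`; `f` takes the final history and a random final location. -/
noncomputable def zoomMean (n : ℕ) : ℕ → List ℕ → ℕ → (List ℕ → ℕ → ℝ) → ℝ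
  | 0, h, a, f => f (h ++ [a + 2 ^ (n - h.length - 1)]) a
  | j + 1, h, a, f => zoomMean n j h a fun h₁ a₁ => zoomMean n j h₁ a₁ fun h₂ a₂ =>
      (j / (j + 1) : ℝ) * f h₂ a₂ + (1 / (j + 1) : ℝ) *
        ((∑ z ∈ (a :: h₁.drop h.length).toFinset, f h₂ z) /
          (a :: h₁.drop h.length).toFinset.card)

lemma zoomMean_add (j : ℕ) : ∀ (h : List ℕ) (a : ℕ) (f g : List ℕ → ℕ → ℝ),
    zoomMean n j h a (fun h' a' => f h' a' + g h' a') =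
      zoomMean n j h a f + zoomMean n j h a g := by
  induction j with
  | zero => intros; rfl
  | succ j ih =>
    intro h a f g
    simp only [zoomMean]
    rw [← ih]
    congr 1
    funext h₁ a₁
    rw [← ih]
    congr 1
    funext h₂ a₂
    rw [Finset.sum_add_distrib]
    ring

lemma zoomMean_const (j : ℕ) : ∀ (h : List ℕ) (a : ℕ) (c : ℝ),
    zoomMean n j h a (fun _ _ => c) = c := by
  induction j with
  | zero => intros; rfl
  | succ j ih =>
    intro h a c
    simp only [zoomMean]
    have : ∀ h₁ : List ℕ, (j / (j + 1) : ℝ) * c + (1 / (j + 1) : ℝ) *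
        ((∑ z ∈ (a :: h₁.drop h.length).toFinset, c) /
          (a :: h₁.drop h.length).toFinset.card) = c := by
      intro h₁
      have hne : ((a :: h₁.drop h.length).toFinset.card : ℝ) ≠ 0 := by
        rw [Nat.cast_ne_zero, Finset.card_ne_zero]
        exact ⟨a, by simp⟩
      rw [Finset.sum_const, nsmul_eq_mul, mul_div_cancel_left₀ _ hne]
      field_simp
    simp only [this, ih]

/-- Linearity is available because the process is oblivious to the algorithm; it lets one random
history serve all blocks at once. -/
lemma zoomMean_sum {ι : Type*} (G : Finset ι) (j : ℕ) (h : List ℕ) (a : ℕ)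
    (f : ι → List ℕ → ℕ → ℝ) :
    zoomMean n j h a (fun h' a' => ∑ i ∈ G, f i h' a') = ∑ i ∈ G, zoomMean n j h a (f i) := by
  classical
  induction G using Finset.induction_on with
  | empty => simp [zoomMean_const]
  | insert i G hi ih => simp only [Finset.sum_insert hi, zoomMean_add, ih]

/-- Also describes the support of the process: the functions need only be compared at outcomes that
add `2 ^ j` fitting entries. -/
lemma zoomMean_mono (j : ℕ) : ∀ (h : List ℕ) (a : ℕ) (f g : List ℕ → ℕ → ℝ),
    Context n h a → h.length + 2 ^ j ≤ n →
    (∀ V a', V.length = 2 ^ j → Fits n h a V → a' ∈ a :: V → f (h ++ V) a' ≤ g (h ++ V) a') →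
    zoomMean n j h a f ≤ zoomMean n j h a g := by
  induction j with
  | zero =>
    intro h a f g hc hn hfg
    refine hfg [_] a rfl ⟨by simpa using hn, by simp, ?_⟩ (by simp)
    intro x hx
    rw [List.mem_singleton] at hx
    subst hx
    have hpos : 0 < 2 ^ (n - h.length - 1) := by positivity
    -- The inserted entry bisects the cell, so it lies on the next finer grid.
    have h2 : 2 ^ (n - h.length) = 2 * 2 ^ (n - h.length - 1) := by
      rw [← pow_succ']; congr 1; omega
    refine ⟨by omega, by omega, ?_⟩
    rw [List.length_append, List.length_singleton, ← Nat.sub_sub]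
    refine dvd_add ((pow_dvd_pow 2 ?_).trans hc.2.2.1) dvd_rfl
    omega
  | succ j ih =>
    intro h a f g hc hn hfg
    rw [pow_succ] at hn hfg
    refine ih h a _ _ hc (by omega) fun V₁ a₁ hl₁ hV₁ ha₁ => ?_
    have hc₁ := hV₁.context hc ha₁
    refine ih _ a₁ _ _ hc₁ (by rw [List.length_append]; omega) fun V₂ a₂ hl₂ hV₂ ha₂ => ?_
    have hV := hV₁.append hc ha₁ hV₂
    have key : ∀ z, z ∈ a :: (V₁ ++ V₂) → f (h ++ V₁ ++ V₂) z ≤ g (h ++ V₁ ++ V₂) z := by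
      intro z hz
      rw [List.append_assoc]
      exact hfg _ z (by rw [List.length_append]; omega) hV hz
    have k1 : f (h ++ V₁ ++ V₂) a₂ ≤ g (h ++ V₁ ++ V₂) a₂ := by
      apply key
      simp only [List.mem_cons, List.mem_append] at ha₁ ha₂ ⊢
      rcases ha₂ with rfl | ha₂ <;> tauto
    simp only [List.drop_left]
    have k2 : ∀ z ∈ (a :: V₁).toFinset, f (h ++ V₁ ++ V₂) z ≤ g (h ++ V₁ ++ V₂) z := by
      intro z hz
      apply key
      simp only [List.mem_toFinset, List.mem_cons, List.mem_append] at hz ⊢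
      tauto
    have k3 := Finset.sum_le_sum k2
    gcongr

/-- The number of stored entries inserted after round `s`, summed over all later times. -/
def storageCost (S : List ℕ → Finset ℕ) (s : ℕ) (h : List ℕ) : ℕ :=
  ∑ t ∈ Finset.Ioc s h.length, ((S (h.take t)).filter fun r => s ≤ r).card

/-- An entry of the first half that is stored at the end was stored at every moment of the second
half, and neither half's own cost counts it there. -/
lemma storageCost_append (hS : Shrinking S) (h V₁ V₂ : List ℕ) :
    storageCost S h.length (h ++ V₁) + storageCost S (h ++ V₁).length (h ++ V₁ ++ V₂) +
      V₂.length * storedIn S h.length (h.length + V₁.length) (h ++ V₁ ++ V₂) ≤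
    storageCost S h.length (h ++ V₁ ++ V₂) := by
  have l₁ : (h ++ V₁).length = h.length + V₁.length := List.length_append
  have l₂ : (h ++ V₁ ++ V₂).length = h.length + V₁.length + V₂.length := by
    rw [List.length_append, l₁]
  unfold storageCost
  rw [l₂, l₁, ← Finset.sum_Ioc_consecutive _ (Nat.le_add_right h.length V₁.length)
    (Nat.le_add_right _ V₂.length), add_assoc]
  apply add_le_add
  · apply le_of_eq
    apply Finset.sum_congr rfl
    intro t ht
    rw [Finset.mem_Ioc] at ht
    rw [List.take_append_of_le_length (l₁ := h ++ V₁) (by omega)]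
  · have : V₂.length = (Finset.Ioc (h.length + V₁.length)
        (h.length + V₁.length + V₂.length)).card := by simp
    nth_rewrite 2 [this]
    rw [← smul_eq_mul, ← Finset.sum_const, ← Finset.sum_add_distrib]
    apply Finset.sum_le_sum
    intro t ht
    rw [Finset.mem_Ioc] at ht
    unfold storedIn
    have hsub : (S (h ++ V₁ ++ V₂)).filter (fun r => h.length ≤ r ∧ r < h.length + V₁.length) ⊆
        (S ((h ++ V₁ ++ V₂).take t)).filter
          (fun r => h.length ≤ r ∧ r < h.length + V₁.length) := by
      intro r hr
      rw [Finset.mem_filter] at hr ⊢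
      refine ⟨hS.mem_of_append _ ((h ++ V₁ ++ V₂).drop t) r ?_ ?_, hr.2⟩
      · rw [List.take_append_drop]; exact hr.1
      · rw [List.length_take]; omega
    refine (Nat.add_le_add_left (Finset.card_le_card hsub) _).trans ?_
    rw [← Finset.card_union_of_disjoint]
    · apply Finset.card_le_card
      intro r hr
      simp only [Finset.mem_union, Finset.mem_filter] at hr ⊢
      rcases hr with hr | hr
      · exact ⟨hr.1, by omega⟩
      · exact ⟨hr.1, hr.2.1⟩
    · rw [Finset.disjoint_filter]
      intro r _ h3 h4
      omega

/-- The main trade-off between stored entries and rank uncertainty. -/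
theorem zoomMean_cost_add_gap_ge (hS : Shrinking S) (j : ℕ) : ∀ (h : List ℕ) (a d : ℕ),
    Context n h a → h.length + 2 ^ j ≤ n → Alt n S h a d →
    (2 ^ j * ((j : ℝ) - 2) / 2 + 1) + 4 * j * gap n S h a ≤
      zoomMean n j h a fun h' a' =>
        (storageCost S h.length h' : ℝ) + 4 * j * gap n S h' a' := by
  induction j with
  | zero =>
    intro h a d _ _ _
    simp [zoomMean]
  | succ j ih =>
    intro h a d hc hn hd
    have hd' := alt_gap hd
    rw [pow_succ] at hn
    set A : ℝ := 2 ^ j * ((j : ℝ) - 2) / 2 + 1 with hA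
    -- The gain of one split: `A` from the second half, the rest from `stored_or_uncertain`. The
    -- recursion `2 * A + (2 ^ j - 1)` reproduces the closed form at `j + 1`.
    set c : ℝ := A + (2 ^ j - 1) + 4 * gap n S h a with hcdef
    have step1 : zoomMean n j h a (fun h' a' =>
          ((storageCost S h.length h' : ℝ) + 4 * j * gap n S h' a') + c) ≤
        zoomMean n (j + 1) h a fun h' a' =>
          (storageCost S h.length h' : ℝ) + 4 * (j + 1 : ℕ) * gap n S h' a' := by
      refine zoomMean_mono j h a _ _ hc (by omega) fun V₁ a₁ hl₁ hV₁ ha₁ => ?_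
      have hc₁ := hV₁.context hc ha₁
      have hd₁ := hd'.extend_self hS hc hV₁ ha₁
      have hn₁ : (h ++ V₁).length + 2 ^ j ≤ n := by rw [List.length_append]; omega
      have step2 := ih _ a₁ _ hc₁ hn₁ hd₁
      refine le_trans ?_ (zoomMean_mono j (h ++ V₁) a₁
        (fun h' a' => ((storageCost S (h ++ V₁).length h' : ℝ) + 4 * j * gap n S h' a') +
          (storageCost S h.length (h ++ V₁) + (2 ^ j - 1) + 4 * gap n S h a)) _ hc₁ hn₁ ?_)
      · rw [zoomMean_add, zoomMean_const]
        linarith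
      · intro V₂ a₂ hl₂ hV₂ ha₂
        have h1 := stored_or_uncertain hS hc hV₁ ha₁ hV₂ hd'
        have h2 := storageCost_append hS h V₁ V₂
        rw [hl₂] at h2
        rw [hl₁] at h1
        have h2' : (storageCost S h.length (h ++ V₁) : ℝ) +
            storageCost S (h ++ V₁).length (h ++ V₁ ++ V₂) +
            2 ^ j * storedIn S h.length (h.length + V₁.length) (h ++ V₁ ++ V₂) ≤
            storageCost S h.length (h ++ V₁ ++ V₂) := by exact_mod_cast h2
        rw [List.drop_left, Finset.sum_add_distrib, Finset.sum_const, nsmul_eq_mul,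
          ← Finset.mul_sum]
        have hcard : ((a :: V₁).toFinset.card : ℝ) ≠ 0 := by
          rw [hV₁.card_locations]; positivity
        rw [add_div, mul_div_cancel_left₀ _ hcard, mul_div_assoc]
        push_cast at h1 ⊢
        rw [hl₁] at h2'
        have hj : (j : ℝ) + 1 ≠ 0 := by positivity
        set X : ℝ := (∑ z ∈ (a :: V₁).toFinset, (gap n S (h ++ V₁ ++ V₂) z : ℝ)) /
          (a :: V₁).toFinset.card
        -- The probabilities are chosen for this identity: weight `4 * (j + 1)` splits into `4 * j`
        -- for the second half's outcome and `4` for the uniform first-half location.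
        have hrw : ∀ C g : ℝ, (j / (j + 1) : ℝ) * (C + 4 * (j + 1) * g) +
            1 / (j + 1) * (C + 4 * (j + 1) * X) = C + 4 * j * g + 4 * X := by
          intro C g; field_simp; ring
        rw [hrw]
        linarith
    refine le_trans ?_ step1
    rw [zoomMean_add, zoomMean_const]
    have step3 := ih h a d hc (by omega) hd
    push_cast
    rw [pow_succ]
    linarith

end ZoomGame

/-! ### Runs of the algorithm depend only on comparisons -/

lemma cmpTable_map_congr {α X : Type*} [LinearOrder X] {κ κ' : α → X} {l : List α}
    (hl : ∀ b ∈ l, ∀ c ∈ l, compare (κ b) (κ c) = compare (κ' b) (κ' c)) :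
    cmpTable (l.map κ) = cmpTable (l.map κ') := by
  unfold cmpTable
  rw [List.map_map, List.map_map]
  refine List.map_congr_left fun b hb => ?_
  simp only [Function.comp_apply, List.map_map]
  exact List.map_congr_left fun c hc => hl b hb c hc

lemma compare_swap_congr {X : Type*} [LinearOrder X] {x y x' y' : X}
    (h : compare x y = compare x' y') : compare y x = compare y' x' := by
  rw [Std.OrientedCmp.eq_swap (cmp := compare) (a := y), h, ← Std.OrientedCmp.eq_swap]

namespace RandCmpAlg

variable {Ω M X : Type*} [LinearOrder X]

/-- Working memory and labels of the stored items after the first `p` items of the stream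
`κ 0, κ 1, …`. -/
def labelState (A : RandCmpAlg Ω M) (ω : Ω) (κ : ℕ → X) : ℕ → M × List ℕ
  | 0 => (A.init ω, [])
  | p + 1 =>
    let s := labelState A ω κ p
    let r := A.update ω s.1 (cmpTable ((p :: s.2).map κ))
    (r.1, r.2.filterMap fun i => (p :: s.2)[i]?)

variable {A : RandCmpAlg Ω M} {ω : Ω} {κ κ' : ℕ → X}

lemma state_map_range (A : RandCmpAlg Ω M) (ω : Ω) (κ : ℕ → X) (p : ℕ) :
    A.state ω ((List.range p).map κ) =
      ((A.labelState ω κ p).1, (A.labelState ω κ p).2.map κ) := by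
  induction p with
  | zero => rfl
  | succ p ih =>
    unfold state at ih ⊢
    rw [List.range_succ, List.map_append, List.foldl_append, ih]
    simp only [List.map_cons, List.map_nil, List.foldl_cons, List.foldl_nil, next, labelState]
    rw [List.map_filterMap]
    congr 2
    funext i
    rw [← List.map_cons, List.getElem?_map]

lemma mem_labelState_succ {p r : ℕ} (hr : r ∈ (A.labelState ω κ (p + 1)).2) :
    r = p ∨ r ∈ (A.labelState ω κ p).2 := by
  simp only [labelState, List.mem_filterMap] at hr
  obtain ⟨i, -, hi⟩ := hr
  exact List.mem_cons.1 (List.mem_of_getElem? hi)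

lemma lt_of_mem_labelState {p r : ℕ} (hr : r ∈ (A.labelState ω κ p).2) : r < p := by
  induction p with
  | zero => simp [labelState] at hr
  | succ p ih =>
    rcases mem_labelState_succ hr with rfl | h
    · omega
    · exact (ih h).trans (Nat.lt_succ_self p)

lemma mem_labelState_of_le {p p' r : ℕ} (hp : p ≤ p') (hr : r ∈ (A.labelState ω κ p').2)
    (hrp : r < p) : r ∈ (A.labelState ω κ p).2 := by
  induction p', hp using Nat.le_induction with
  | base => exact hr
  | succ p' hp ih =>
    rcases mem_labelState_succ hr with rfl | h
    · omega
    · exact ih h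

/-- Two streams are processed alike if every arriving item compares in the same way with the
items that are stored when it arrives. -/
lemma labelState_congr {P : ℕ}
    (hP : ∀ p < P, ∀ b ∈ (A.labelState ω κ p).2,
      compare (κ b) (κ p) = compare (κ' b) (κ' p)) :
    A.labelState ω κ P = A.labelState ω κ' P ∧
      ∀ b ∈ (A.labelState ω κ P).2, ∀ c ∈ (A.labelState ω κ P).2,
        compare (κ b) (κ c) = compare (κ' b) (κ' c) := by
  induction P with
  | zero => simp [labelState]
  | succ P ih =>
    obtain ⟨h1, h2⟩ := ih fun p hp => hP p (by omega)
    have h3 := hP P (Nat.lt_succ_self P)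
    have hall : ∀ b ∈ P :: (A.labelState ω κ P).2, ∀ c ∈ P :: (A.labelState ω κ P).2,
        compare (κ b) (κ c) = compare (κ' b) (κ' c) := by
      intro b hb c hc
      rcases List.mem_cons.1 hb with rfl | hb <;> rcases List.mem_cons.1 hc with rfl | hc
      · rw [compare_eq_iff_eq.2 rfl, compare_eq_iff_eq.2 rfl]
      · exact compare_swap_congr (h3 c hc)
      · exact h3 b hb
      · exact h2 b hb c hc
    constructor
    · simp only [labelState]
      rw [cmpTable_map_congr hall, h1]
    · intro b hb c hc
      exact hall b (List.mem_cons.2 (mem_labelState_succ hb)) c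
        (List.mem_cons.2 (mem_labelState_succ hc))

/-- Two queries get the same answer if the streams are processed alike and the queries compare in
the same way with the stored items. -/
lemma estimate_congr {P : ℕ} {x x' : X}
    (hP : ∀ p < P, ∀ b ∈ (A.labelState ω κ p).2,
      compare (κ b) (κ p) = compare (κ' b) (κ' p))
    (hx : ∀ b ∈ (A.labelState ω κ P).2, compare (κ b) x = compare (κ' b) x') :
    A.estimate ω ((List.range P).map κ) x = A.estimate ω ((List.range P).map κ') x' := by
  obtain ⟨h1, h2⟩ := labelState_congr hP
  unfold estimate stored
  rw [state_map_range, state_map_range, ← h1]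
  simp only
  congr 1
  -- The query carries no label; it is adjoined as `none`.
  have h3 := cmpTable_map_congr (l := none :: (A.labelState ω κ P).2.map some)
    (κ := fun o => Option.elim o x κ) (κ' := fun o => Option.elim o x' κ') ?_
  · simpa [List.map_map, Function.comp_def] using h3
  intro b hb c hc
  simp only [List.mem_cons, List.mem_map] at hb hc
  rcases hb with rfl | ⟨b, hb, rfl⟩ <;> rcases hc with rfl | ⟨c, hc, rfl⟩ <;>
    simp only [Option.elim]
  · rw [compare_eq_iff_eq.2 rfl, compare_eq_iff_eq.2 rfl]
  · exact compare_swap_congr (hx c hc)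
  · exact hx b hb
  · exact h2 b hb c hc

end RandCmpAlg

/-! ### Playing the game in many blocks at once -/

namespace ZoomGame

variable {Ω M X : Type*} [LinearOrder X]

/-- The item with label `p`: round `p / m`, block `p % m`, with the offset list `o (p % m)`. -/
def blockItem (m n : ℕ) (f : ℕ → X) (o : ℕ → List ℕ) (p : ℕ) : X :=
  f (p % m * 2 ^ (n + 1) + 2 * (o (p % m)).getD (p / m) 0)

/-- The stream in which block `i` uses the offsets `τ` and all other blocks use `h`. -/
def blockStream (m n : ℕ) (f : ℕ → X) (h : List ℕ) (i : ℕ) (τ : List ℕ) : List X :=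
  (List.range (n * m)).map (blockItem m n f (Function.update (fun _ => h) i τ))

/-- A query item in block `i` immediately after the offset `a`. -/
def blockQuery (n : ℕ) (f : ℕ → X) (i a : ℕ) : X := f (i * 2 ^ (n + 1) + (2 * a + 1))

/-- The rounds whose items in block `i` are stored after all blocks have received `h`. -/
noncomputable def blockStored (A : RandCmpAlg Ω M) (ω : Ω) (m n : ℕ) (f : ℕ → X) (i : ℕ)
    (h : List ℕ) : Finset ℕ := by
  classical exact (Finset.range h.length).filter fun t =>
    t * m + i ∈ (A.labelState ω (blockItem m n f fun _ => h) (h.length * m)).2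

variable {A : RandCmpAlg Ω M} {ω : Ω} {m n : ℕ} {f : ℕ → X} {i : ℕ}

lemma mem_blockStored {h : List ℕ} {t : ℕ} : t ∈ blockStored A ω m n f i h ↔
    t < h.length ∧
      t * m + i ∈ (A.labelState ω (blockItem m n f fun _ => h) (h.length * m)).2 := by
  classical
  simp [blockStored]

lemma add_mod_div {t : ℕ} (hi : i < m) : (t * m + i) % m = i ∧ (t * m + i) / m = t := by
  constructor
  · rw [Nat.mul_add_mod', Nat.mod_eq_of_lt hi]
  · rw [mul_comm, Nat.mul_add_div (by omega), Nat.div_eq_of_lt hi, add_zero]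

/-- All blocks finish a round before the next begins, so the first `h.length * m` items use only
offsets from `h`. -/
lemma labelState_blockItem_append (h V : List ℕ) :
    A.labelState ω (blockItem m n f fun _ => h ++ V) (h.length * m) =
      A.labelState ω (blockItem m n f fun _ => h) (h.length * m) := by
  have heq : ∀ p < h.length * m,
      blockItem m n f (fun _ => h ++ V) p = blockItem m n f (fun _ => h) p := by
    intro p hp
    unfold blockItem
    rw [List.getD_append _ _ _ _ (Nat.div_lt_of_lt_mul (by rwa [mul_comm] at hp))]
  refine (RandCmpAlg.labelState_congr fun p hp b hb => ?_).1
  rw [heq p hp, heq b ((RandCmpAlg.lt_of_mem_labelState hb).trans hp)]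

lemma shrinking_blockStored (A : RandCmpAlg Ω M) (ω : Ω) (f : ℕ → X) (hi : i < m) :
    Shrinking (blockStored A ω m n f i) := by
  refine ⟨by ext; simp [mem_blockStored], fun h x t ht => ?_⟩
  rw [mem_blockStored, List.length_append, List.length_singleton] at ht
  rw [Finset.mem_insert, mem_blockStored]
  rcases Nat.lt_or_ge t h.length with h1 | h1
  · refine Or.inr ⟨h1, ?_⟩
    rw [← labelState_blockItem_append h [x]]
    refine RandCmpAlg.mem_labelState_of_le (Nat.mul_le_mul_right m (Nat.le_succ _)) ht.2 ?_
    nlinarith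
  · left; omega

/-- The stored items of different blocks are counted separately. -/
lemma sum_card_blockStored_le (A : RandCmpAlg Ω M) (ω : Ω) (f : ℕ → X) (G : Finset ℕ)
    (hG : ∀ i ∈ G, i < m) (h : List ℕ) :
    ∑ i ∈ G, (blockStored A ω m n f i h).card ≤
      (A.stored ω ((List.range (h.length * m)).map (blockItem m n f fun _ => h))).length := by
  unfold RandCmpAlg.stored
  rw [RandCmpAlg.state_map_range, List.length_map, ← Finset.card_sigma]
  refine le_trans (Finset.card_le_card_of_injOn (fun x => x.2 * m + x.1) (t :=
    (A.labelState ω (blockItem m n f fun _ => h) (h.length * m)).2.toFinset) ?_ ?_)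
    (List.toFinset_card_le _)
  · intro x hx
    have hx' := Finset.mem_sigma.1 (Finset.mem_coe.1 hx)
    exact Finset.mem_coe.2 (List.mem_toFinset.2 (mem_blockStored.1 hx'.2).2)
  · rintro ⟨i, t⟩ hx ⟨i', t'⟩ hx' heq
    have h1 := hG _ (Finset.mem_sigma.1 (Finset.mem_coe.1 hx)).1
    have h2 := hG _ (Finset.mem_sigma.1 (Finset.mem_coe.1 hx')).1
    simp only at h1 h2 heq
    have h3 := add_mod_div (t := t) h1
    have h4 := add_mod_div (t := t') h2
    rw [heq] at h3
    obtain rfl : i = i' := h3.1.symm.trans h4.1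
    obtain rfl : t = t' := h3.2.symm.trans h4.2
    rfl

lemma offsetRank_eq_card (h : List ℕ) (a : ℕ) :
    offsetRank h a = ((Finset.range h.length).filter fun t => h.getD t 0 ≤ a).card := by
  have : h = (List.range h.length).map fun t => h.getD t 0 := by
    apply List.ext_getElem
    · simp
    · intro t h1 h2
      simp [h1]
  unfold offsetRank
  nth_rewrite 1 [this]
  rw [List.countP_map, List.countP_eq_length_filter]
  rfl

lemma block_lt (hi : i < m) {w : ℕ} (hw : w < 2 ^ (n + 1)) :
    i * 2 ^ (n + 1) + w < m * 2 ^ (n + 1) := by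
  calc i * 2 ^ (n + 1) + w < (i + 1) * 2 ^ (n + 1) := by rw [add_mul]; omega
    _ ≤ m * 2 ^ (n + 1) := Nat.mul_le_mul_right _ hi

lemma getD_lt_two_pow {l : List ℕ} (hl : ∀ x ∈ l, x < 2 ^ n) (t : ℕ) : l.getD t 0 < 2 ^ n := by
  rw [List.getD_eq_getElem?_getD]
  cases hx : l[t]? with
  | none => simp
  | some x => exact hl x (List.mem_of_getElem? hx)

lemma update_lt_two_pow {h τ : List ℕ} (hh : ∀ x ∈ h, x < 2 ^ n) (hτ : ∀ x ∈ τ, x < 2 ^ n)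
    (i' t : ℕ) : (Function.update (fun _ => h) i τ i').getD t 0 < 2 ^ n := by
  by_cases h1 : i' = i
  · subst h1; rw [Function.update_self]; exact getD_lt_two_pow hτ t
  · rw [Function.update_of_ne h1]; exact getD_lt_two_pow hh t

/-- Blocks are order-separated, so lower blocks contribute a number independent of all offsets, and
rank differences within block `i` are differences of `offsetRank`. -/
lemma streamRank_blockStream (hf : StrictMonoOn f (Set.Iio (m * 2 ^ (n + 1)))) (hi : i < m)
    {h τ : List ℕ} (hh : ∀ x ∈ h, x < 2 ^ n) (hτ : ∀ x ∈ τ, x < 2 ^ n) (hlen : τ.length = n)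
    {a : ℕ} (ha : a < 2 ^ n) :
    streamRank (blockStream m n f h i τ) (blockQuery n f i a) =
      ((Finset.range (n * m)).filter fun p => p % m < i).card + offsetRank τ a := by
  have hle : ∀ p, blockItem m n f (Function.update (fun _ => h) i τ) p ≤ blockQuery n f i a ↔
      (p % m < i ∨ (p % m = i ∧ τ.getD (p / m) 0 ≤ a)) := by
    intro p
    have hpm : p % m < m := Nat.mod_lt _ (by omega)
    have hlt := update_lt_two_pow (i := i) hh hτ (p % m) (p / m)
    unfold blockItem blockQuery
    have hpow : 2 ^ (n + 1) = 2 * 2 ^ n := pow_succ' 2 n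
    rw [hf.le_iff_le (Set.mem_Iio.2 (block_lt hpm (by omega)))
      (Set.mem_Iio.2 (block_lt hi (by omega)))]
    rcases lt_trichotomy (p % m) i with h1 | h1 | h1
    · refine iff_of_true ?_ (Or.inl h1)
      have : (p % m + 1) * 2 ^ (n + 1) ≤ i * 2 ^ (n + 1) := Nat.mul_le_mul_right _ h1
      rw [add_mul] at this
      omega
    · rw [h1, Function.update_self]
      omega
    · refine iff_of_false ?_ (by omega)
      have : (i + 1) * 2 ^ (n + 1) ≤ p % m * 2 ^ (n + 1) := Nat.mul_le_mul_right _ h1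
      rw [add_mul] at this
      omega
  have h1 : streamRank (blockStream m n f h i τ) (blockQuery n f i a) =
      ((Finset.range (n * m)).filter fun p =>
        p % m < i ∨ (p % m = i ∧ τ.getD (p / m) 0 ≤ a)).card := by
    unfold streamRank blockStream
    rw [List.countP_map, List.countP_eq_length_filter]
    simp only [Function.comp_def, hle]
    rfl
  rw [h1, Finset.filter_or, Finset.card_union_of_disjoint, offsetRank_eq_card, hlen]
  · congr 1
    refine (Finset.card_nbij' (fun t => t * m + i) (fun p => p / m) ?_ ?_ ?_ ?_).symm
    · intro t ht
      simp only [Finset.mem_coe, Finset.mem_filter, Finset.mem_range] at ht ⊢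
      obtain ⟨e1, e2⟩ := add_mod_div (t := t) hi
      rw [e1, e2]
      refine ⟨?_, rfl, ht.2⟩
      calc t * m + i < (t + 1) * m := by rw [add_mul]; omega
        _ ≤ n * m := Nat.mul_le_mul_right _ ht.1
    · intro p hp
      simp only [Finset.mem_coe, Finset.mem_filter, Finset.mem_range] at hp ⊢
      exact ⟨Nat.div_lt_of_lt_mul (by rw [mul_comm]; exact hp.1), hp.2.2⟩
    · intro t _
      exact (add_mod_div hi).2
    · intro p hp
      simp only [Finset.mem_coe, Finset.mem_filter, Finset.mem_range] at hp
      have := Nat.div_add_mod' p m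
      simp only
      omega
  · rw [Finset.disjoint_filter]
    intro p _ h3 h4
    omega

/-- With seed `ω`, all queries in block `i` are answered with error at most `e`, whatever grid
offsets block `i` and the other blocks use. -/
def BlockCorrect (A : RandCmpAlg Ω M) (ω : Ω) (m n : ℕ) (f : ℕ → X) (i : ℕ) (e : ℝ) : Prop :=
  ∀ h τ : List ℕ, h.length = n → τ.length = n → (∀ x ∈ h, x < 2 ^ n) → (∀ x ∈ τ, x < 2 ^ n) →
    ∀ a < 2 ^ n, |A.estimate ω (blockStream m n f h i τ) (blockQuery n f i a) -
      (streamRank (blockStream m n f h i τ) (blockQuery n f i a) : ℝ)| ≤ e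

lemma compare_congr_of_lt {x y x' y' : X} (h : (x < y ∧ x' < y') ∨ (y < x ∧ y' < x')) :
    compare x y = compare x' y' := by
  rcases h with ⟨h1, h2⟩ | ⟨h1, h2⟩
  · rw [compare_lt_iff_lt.2 h1, compare_lt_iff_lt.2 h2]
  · rw [compare_gt_iff_gt.2 h1, compare_gt_iff_gt.2 h2]

/-- A correct algorithm has small rank uncertainty. -/
lemma Alt.le_of_blockCorrect (hf : StrictMonoOn f (Set.Iio (m * 2 ^ (n + 1)))) (hi : i < m)
    {e : ℝ} (hgood : BlockCorrect A ω m n f i e) {h : List ℕ} {a d : ℕ} (hlen : h.length = n)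
    (hc : Context n h a) (hd : Alt n (blockStored A ω m n f i) h a d) : (d : ℝ) ≤ 2 * e := by
  obtain ⟨τ, b, hsh, hτ, hb, hloc, hr⟩ := hd
  have hh' : ∀ x ∈ h, x < 2 ^ n := fun x hx => (hc.2.1 x hx).2
  have hτ' : ∀ x ∈ τ, x < 2 ^ n := fun x hx => (hτ x hx).2
  have hτlen : τ.length = n := hsh.1.trans hlen
  have hpow : 2 ^ (n + 1) = 2 * 2 ^ n := pow_succ' 2 n
  have g1 := hgood h h hlen hlen hh' hh' a hc.2.2.2
  have g2 := hgood h τ hlen hτlen hh' hτ' b hb.2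
  rw [streamRank_blockStream hf hi hh' hh' hlen hc.2.2.2] at g1
  rw [streamRank_blockStream hf hi hh' hτ' hτlen hb.2, hr] at g2
  have hupd : Function.update (fun _ => h) i h = fun _ : ℕ => h := Function.update_eq_self _ _
  have hitem : ∀ p, blockItem m n f (fun _ => h) p =
      f (p % m * 2 ^ (n + 1) + 2 * h.getD (p / m) 0) := fun _ => rfl
  have hest : A.estimate ω (blockStream m n f h i h) (blockQuery n f i a) =
      A.estimate ω (blockStream m n f h i τ) (blockQuery n f i b) := by
    unfold blockStream
    rw [hupd]
    have hpm : ∀ p, p % m < m := fun p => Nat.mod_lt _ (by omega)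
    have hin : ∀ p w, w ≤ 2 * 2 ^ n - 1 →
        p % m * 2 ^ (n + 1) + w ∈ Set.Iio (m * 2 ^ (n + 1)) := by
      intro p w hw
      have : 0 < 2 ^ n := by positivity
      exact block_lt (hpm p) (by omega)
    have hblocks : ∀ p q w w' : ℕ, p < q → w ≤ 2 * 2 ^ n - 1 →
        p * 2 ^ (n + 1) + w < q * 2 ^ (n + 1) + w' := by
      intro p q w w' hpq hw
      have : (p + 1) * 2 ^ (n + 1) ≤ q * 2 ^ (n + 1) := Nat.mul_le_mul_right _ hpq
      have : 0 < 2 ^ n := by positivity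
      rw [add_mul] at *
      omega
    have b1 : ∀ t, 2 * h.getD t 0 ≤ 2 * 2 ^ n - 1 := fun t => by
      have := getD_lt_two_pow hh' t; omega
    have b2 : ∀ i' t, 2 * (Function.update (fun _ => h) i τ i').getD t 0 ≤ 2 * 2 ^ n - 1 :=
      fun i' t => by
        have := update_lt_two_pow (i := i) hh' hτ' i' t; omega
    refine RandCmpAlg.estimate_congr (fun p hp r hrp => ?_) fun r hrp => ?_
    · have hrlt := RandCmpAlg.lt_of_mem_labelState hrp
      unfold blockItem
      rcases lt_trichotomy (r % m) (p % m) with h1 | h1 | h1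
      · exact compare_congr_of_lt (Or.inl
          ⟨(hf.lt_iff_lt (hin _ _ (b1 _)) (hin _ _ (b1 _))).2 (hblocks _ _ _ _ h1 (b1 _)),
            (hf.lt_iff_lt (hin _ _ (b2 _ _)) (hin _ _ (b2 _ _))).2 (hblocks _ _ _ _ h1 (b2 _ _))⟩)
      · by_cases h2 : p % m = i
        · have hdp := Nat.div_add_mod' p m
          have hdr := Nat.div_add_mod' r m
          have hdiv : r / m < p / m := by
            by_contra hcon
            have := Nat.mul_le_mul_right m (not_lt.1 hcon)
            omega
          have hpn : p / m < h.length :=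
            hlen ▸ Nat.div_lt_of_lt_mul (by rw [mul_comm]; exact hp)
          have htk : (h.take (p / m)).length = p / m := by rw [List.length_take]; omega
          -- `Shadow` speaks of the stored set at the start of the round. Since `r` belongs to an
          -- earlier round and is stored now, it was stored then.
          have hst : r / m ∈ blockStored A ω m n f i (h.take (p / m)) := by
            rw [mem_blockStored, htk]
            refine ⟨hdiv, ?_⟩
            have happ := labelState_blockItem_append (A := A) (ω := ω) (m := m) (n := n) (f := f)
              (h.take (p / m)) (h.drop (p / m))
            rw [List.take_append_drop, htk] at happ
            rw [← happ, ← h2, ← h1, hdr]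
            refine RandCmpAlg.mem_labelState_of_le ?_ hrp ?_
            · omega
            · have := Nat.mul_le_mul_right m (Nat.succ_le_of_lt hdiv)
              have := hpm r
              rw [Nat.succ_mul] at *
              omega
          have hs := hsh.2 _ hpn _ hst
          have hrm : r % m = i := h1.trans h2
          apply compare_congr_of_lt
          rw [hf.lt_iff_lt (hin _ _ (b1 _)) (hin _ _ (b1 _)),
            hf.lt_iff_lt (hin _ _ (b1 _)) (hin _ _ (b1 _)),
            hf.lt_iff_lt (hin _ _ (b2 _ _)) (hin _ _ (b2 _ _)),
            hf.lt_iff_lt (hin _ _ (b2 _ _)) (hin _ _ (b2 _ _)), h1, h2, Function.update_self]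
          omega
        · rw [h1, Function.update_of_ne h2]
      · exact compare_congr_of_lt (Or.inr
          ⟨(hf.lt_iff_lt (hin _ _ (b1 _)) (hin _ _ (b1 _))).2 (hblocks _ _ _ _ h1 (b1 _)),
            (hf.lt_iff_lt (hin _ _ (b2 _ _)) (hin _ _ (b2 _ _))).2 (hblocks _ _ _ _ h1 (b2 _ _))⟩)
    · unfold blockItem blockQuery
      have hia : i * 2 ^ (n + 1) + (2 * a + 1) ∈ Set.Iio (m * 2 ^ (n + 1)) :=
        block_lt hi (by have := hc.2.2.2; omega)
      have hib : i * 2 ^ (n + 1) + (2 * b + 1) ∈ Set.Iio (m * 2 ^ (n + 1)) :=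
        block_lt hi (by have := hb.2; omega)
      apply compare_congr_of_lt
      rw [hf.lt_iff_lt (hin _ _ (b1 _)) hia, hf.lt_iff_lt hia (hin _ _ (b1 _)),
        hf.lt_iff_lt (hin _ _ (b2 _ _)) hib, hf.lt_iff_lt hib (hin _ _ (b2 _ _))]
      have ba : 2 * a + 1 ≤ 2 * 2 ^ n - 1 := by have := hc.2.2.2; omega
      have bb : 2 * b + 1 ≤ 2 * 2 ^ n - 1 := by have := hb.2; omega
      rcases lt_trichotomy (r % m) i with h1 | h1 | h1
      · exact Or.inl ⟨hblocks _ _ _ _ h1 (b1 _), hblocks _ _ _ _ h1 (b2 _ _)⟩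
      · have hdr := Nat.div_add_mod' r m
        have hst : r / m ∈ blockStored A ω m n f i h := by
          rw [mem_blockStored, hlen, ← h1, hdr]
          refine ⟨Nat.div_lt_of_lt_mul ?_, hrp⟩
          rw [mul_comm]; exact RandCmpAlg.lt_of_mem_labelState hrp
        have hs := hloc _ hst
        rw [h1, Function.update_self]
        omega
      · exact Or.inr ⟨hblocks _ _ _ _ h1 ba, hblocks _ _ _ _ h1 bb⟩
  rw [hest] at g1
  rw [abs_le] at g1 g2
  push_cast at g1 g2
  linarith

/-- A seed that is correct on the blocks in `G` needs much storage on some stream. -/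
theorem storage_ge_of_blockCorrect (hf : StrictMonoOn f (Set.Iio (m * 2 ^ (n + 1))))
    (G : Finset ℕ) (hG : ∀ i ∈ G, i < m) {e : ℝ}
    (hgood : ∀ i ∈ G, BlockCorrect A ω m n f i e) {k s : ℕ} (hn : n = 2 ^ k)
    (hs : ∀ h : List ℕ,
      (A.stored ω ((List.range (h.length * m)).map (blockItem m n f fun _ => h))).length ≤ s) :
    (G.card : ℝ) * (n * ((k : ℝ) - 2) / 2 - 8 * k * e) ≤ n * s := by
  have hc0 : Context n [] 0 := ⟨by simp, by simp, dvd_zero _, by positivity⟩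
  have hnR : (n : ℝ) = 2 ^ k := by rw [hn]; push_cast; rfl
  have hlow : ∀ i ∈ G, n * ((k : ℝ) - 2) / 2 ≤ zoomMean n k [] 0 fun h' a' =>
      (storageCost (blockStored A ω m n f i) 0 h' : ℝ) +
        4 * k * gap n (blockStored A ω m n f i) h' a' := by
    intro i hi
    have hS := shrinking_blockStored (n := n) A ω f (hG i hi)
    have h1 := zoomMean_cost_add_gap_ge hS k [] 0 0 hc0 (by simp [hn]) (alt_nil hS)
    refine le_trans ?_ h1
    rw [hnR]
    have : (0 : ℝ) ≤ 4 * k * gap n (blockStored A ω m n f i) [] 0 := by positivity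
    linarith
  have hsum := Finset.sum_le_sum hlow
  rw [← zoomMean_sum, Finset.sum_const, nsmul_eq_mul] at hsum
  -- At each of the `n` times the blocks share at most `s` stored items; the uncertainty term is at
  -- most `4 * k * (2 * e)` per block.
  have hup : zoomMean n k [] 0 (fun h' a' => ∑ i ∈ G,
      ((storageCost (blockStored A ω m n f i) 0 h' : ℝ) +
        4 * k * gap n (blockStored A ω m n f i) h' a')) ≤
      zoomMean n k [] 0 (fun _ _ => (n * s + G.card * (8 * k * e) : ℝ)) := by
    refine zoomMean_mono k [] 0 _ _ hc0 (by simp [hn]) fun V a' hl hV ha' => ?_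
    have hc' := hV.context hc0 ha'
    have hlen : ([] ++ V).length = n := by rw [hn]; simpa using hl
    rw [Finset.sum_add_distrib]
    apply add_le_add
    · rw [← Nat.cast_sum, ← Nat.cast_mul, Nat.cast_le]
      unfold storageCost
      rw [Finset.sum_comm, hlen]
      calc _ ≤ ∑ t ∈ Finset.Ioc 0 n, s := by
            refine Finset.sum_le_sum fun t _ => ?_
            refine le_trans (Finset.sum_le_sum fun i _ => Finset.card_filter_le _ _) ?_
            exact (sum_card_blockStored_le A ω f G hG _).trans (hs _)
        _ = n * s := by simp
    · rw [← nsmul_eq_mul, ← Finset.sum_const]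
      refine Finset.sum_le_sum fun i hi => ?_
      have hS := shrinking_blockStored (n := n) A ω f (hG i hi)
      have h2 := (alt_gap ((alt_nil hS).extend_self hS hc0 hV ha')).le_of_blockCorrect hf
        (hG i hi) (hgood i hi) hlen hc'
      have h3 : (0 : ℝ) ≤ 4 * k := by positivity
      have h4 := mul_le_mul_of_nonneg_left h2 h3
      linarith
  rw [zoomMean_const] at hup
  linarith

end ZoomGame

/-! ### Fixing a good seed -/

lemma exists_strictMonoOn_Iio (X : Type*) [LinearOrder X] [Infinite X] (N : ℕ) :
    ∃ f : ℕ → X, StrictMonoOn f (Set.Iio N) := by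
  classical
  obtain ⟨s, hs⟩ := Infinite.exists_subset_card_eq X N
  refine ⟨fun p => if hp : p < N then s.orderEmbOfFin hs ⟨p, hp⟩ else Classical.arbitrary X, ?_⟩
  intro p hp q hq hpq
  simp only [Set.mem_Iio] at hp hq
  simp only [hp, hq, dif_pos]
  exact (s.orderEmbOfFin hs).strictMono hpq

/-- If each of `m` events has probability at most `1 / 4`, then some outcome avoids half of them. -/
lemma exists_avoiding_half {Ω : Type*} [MeasurableSpace Ω] (P : Measure Ω)
    [IsProbabilityMeasure P] {m : ℕ} (hm : 0 < m) (B : ℕ → Set Ω)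
    (hB : ∀ i < m, 4 * P (B i) ≤ 1) {Q : Ω → Prop} (hQ : ∀ᵐ ω ∂P, Q ω) :
    ∃ ω, Q ω ∧ ∃ G : Finset ℕ, (∀ i ∈ G, i < m ∧ ω ∉ B i) ∧ m ≤ 2 * G.card := by
  classical
  by_contra hcon
  push Not at hcon
  -- The events need not be measurable; their measurable hulls have the same measure, and avoiding a
  -- hull avoids the event.
  set T : ℕ → Set Ω := fun i => toMeasurable P (B i) with hT
  have hTm : ∀ i, MeasurableSet (T i) := fun i => measurableSet_toMeasurable _ _
  have hpoint : ∀ᵐ ω ∂P, (m : ENNReal) ≤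
      2 * ∑ i ∈ Finset.range m, (T i).indicator (fun _ => (1 : ENNReal)) ω := by
    filter_upwards [hQ] with ω hω
    have h1 := hcon ω hω ((Finset.range m).filter fun i => ω ∉ T i) (by
      intro i hi
      rw [Finset.mem_filter, Finset.mem_range] at hi
      exact ⟨hi.1, fun h => hi.2 (subset_toMeasurable _ _ h)⟩)
    have h2 := Finset.card_filter_add_card_filter_not (s := Finset.range m) (fun i => ω ∈ T i)
    rw [Finset.card_range] at h2
    have h3 : ∑ i ∈ Finset.range m, (T i).indicator (fun _ => (1 : ENNReal)) ω =
        (((Finset.range m).filter fun i => ω ∈ T i).card : ENNReal) := by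
      rw [Finset.card_filter]
      push_cast
      refine Finset.sum_congr rfl fun i _ => ?_
      simp [Set.indicator_apply]
    rw [h3]
    exact_mod_cast (by omega : m ≤ 2 * ((Finset.range m).filter fun i => ω ∈ T i).card)
  have h4 := lintegral_mono_ae hpoint
  rw [lintegral_const, measure_univ, mul_one, lintegral_const_mul _
    (Finset.measurable_sum _ fun i _ => measurable_const.indicator (hTm i)),
    lintegral_finsetSum _ fun i _ => measurable_const.indicator (hTm i)] at h4
  have h5 : ∀ i ∈ Finset.range m,
      4 * ∫⁻ ω, (T i).indicator (fun _ => (1 : ENNReal)) ω ∂P ≤ 1 := by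
    intro i hi
    rw [lintegral_indicator_const (hTm i), one_mul, hT, measure_toMeasurable]
    exact hB i (Finset.mem_range.1 hi)
  have h6 := Finset.sum_le_sum h5
  rw [← Finset.mul_sum, Finset.sum_const, Finset.card_range, nsmul_eq_mul, mul_one] at h6
  have h7 : (2 : ENNReal) * m ≤ m := by
    calc (2 : ENNReal) * m ≤ 2 * (2 * _) := mul_le_mul_right h4 2
      _ = 4 * _ := by rw [← mul_assoc]; norm_num
      _ ≤ m := h6
  have h8 : 2 * m ≤ m := by exact_mod_cast h7
  omega

namespace ZoomGame

variable {Ω M X : Type*} [LinearOrder X]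

/-- A union bound over the grid offsets of block `i`, the common grid offsets of the other blocks
and the queries in block `i`. -/
lemma measure_not_blockCorrect_le [MeasurableSpace Ω] (P : Measure Ω) {A : RandCmpAlg Ω M}
    {ε δ : ℝ} (hA : SolvesSingleQuantile P X A ε δ) (m n : ℕ) (f : ℕ → X) (i : ℕ)
    (hsmall : 4 * ((2 : ℝ) ^ (2 * n ^ 2 + n) * δ) ≤ 1) :
    4 * P {ω | ¬ BlockCorrect A ω m n f i (ε * (n * m : ℕ))} ≤ 1 := by
  set I := (Fin n → Fin (2 ^ n)) × (Fin n → Fin (2 ^ n)) × Fin (2 ^ n)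
  set l : (Fin n → Fin (2 ^ n)) → List ℕ := fun v => List.ofFn fun t => (v t : ℕ) with hl
  set D : I → Set Ω := fun v => {ω |
    ε * ((blockStream m n f (l v.1) i (l v.2.1)).length : ℝ) <
      |A.estimate ω (blockStream m n f (l v.1) i (l v.2.1)) (blockQuery n f i v.2.2) -
        (streamRank (blockStream m n f (l v.1) i (l v.2.1)) (blockQuery n f i v.2.2) : ℝ)|}
    with hD
  have hlist : ∀ h : List ℕ, h.length = n → (∀ x ∈ h, x < 2 ^ n) → ∃ v, l v = h := by
    intro h hlen hh
    subst hlen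
    exact ⟨fun t => ⟨h[t], hh _ (List.getElem_mem _)⟩, List.ofFn_getElem⟩
  have hsub : {ω | ¬ BlockCorrect A ω m n f i (ε * (n * m : ℕ))} ⊆ ⋃ v, D v := by
    intro ω hω
    by_contra hcon
    refine hω fun h τ hh hτ hh' hτ' a ha => ?_
    obtain ⟨v, rfl⟩ := hlist h hh hh'
    obtain ⟨w, rfl⟩ := hlist τ hτ hτ'
    rw [Set.mem_iUnion, not_exists] at hcon
    have h1 := hcon (v, w, ⟨a, ha⟩)
    have h2 : (blockStream m n f (l v) i (l w)).length = n * m := by simp [blockStream]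
    simp only [hD, Set.mem_ofPred_eq, not_lt, h2] at h1
    exact h1
  have hcard : Fintype.card I = 2 ^ (2 * n ^ 2 + n) := by
    simp only [I, Fintype.card_prod, Fintype.card_fun, Fintype.card_fin]
    rw [← pow_mul, ← pow_add, ← pow_add]
    congr 1; ring
  have h1 : P {ω | ¬ BlockCorrect A ω m n f i (ε * (n * m : ℕ))} ≤
      ENNReal.ofReal ((2 : ℝ) ^ (2 * n ^ 2 + n) * δ) := by
    calc _ ≤ P (⋃ v, D v) := measure_mono hsub
      _ ≤ ∑ v, P (D v) := measure_iUnion_fintype_le P D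
      _ ≤ ∑ _v : I, ENNReal.ofReal δ := Finset.sum_le_sum fun v _ => hA _ _
      _ = ENNReal.ofReal ((2 : ℝ) ^ (2 * n ^ 2 + n) * δ) := by
        rw [Finset.sum_const, Finset.card_univ, hcard, nsmul_eq_mul,
          ENNReal.ofReal_mul (by positivity), ENNReal.ofReal_pow (by norm_num)]
        simp
  calc _ ≤ 4 * ENNReal.ofReal ((2 : ℝ) ^ (2 * n ^ 2 + n) * δ) := mul_le_mul_right h1 4
    _ = ENNReal.ofReal (4 * ((2 : ℝ) ^ (2 * n ^ 2 + n) * δ)) := by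
      rw [ENNReal.ofReal_mul (by norm_num)]; simp
    _ ≤ 1 := by rw [← ENNReal.ofReal_one]; exact ENNReal.ofReal_le_ofReal hsmall

/-- The storage bound in terms of the number `m` of blocks and the depth `k` of the zooming. -/
theorem storage_ge [Infinite X] [MeasurableSpace Ω] (P : Measure Ω) [IsProbabilityMeasure P]
    {A : RandCmpAlg Ω M} {ε δ : ℝ} (hA : SolvesSingleQuantile P X A ε δ)
    {s : ℕ} (hs : StoresAtMost P X A s) {m k : ℕ} (hm : 0 < m) (hmε : 32 * (ε * m) ≤ 1)
    (hk : 8 ≤ k) (hsmall : 4 * ((2 : ℝ) ^ (2 * (2 ^ k) ^ 2 + 2 ^ k) * δ) ≤ 1) :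
    (m : ℝ) * k / 16 ≤ s := by
  obtain ⟨n, hn⟩ : ∃ n, n = 2 ^ k := ⟨_, rfl⟩
  rw [← hn] at hsmall
  obtain ⟨f, hf⟩ := exists_strictMonoOn_Iio X (m * 2 ^ (n + 1))
  have hae : ∀ᵐ ω ∂P, ∀ h : List ℕ,
      (A.stored ω ((List.range (h.length * m)).map (blockItem m n f fun _ => h))).length ≤ s :=
    -- There are only countably many offset lists, so a single null set suffices.
    ae_all_iff.2 fun h => hs _
  obtain ⟨ω, hω, G, hG, hGm⟩ := exists_avoiding_half P hm
    (fun i => {ω | ¬ BlockCorrect A ω m n f i (ε * (n * m : ℕ))})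
    (fun i _ => measure_not_blockCorrect_le P hA m n f i hsmall) hae
  have h1 := storage_ge_of_blockCorrect hf G (fun i hi => (hG i hi).1)
    (fun i hi => not_not.1 (hG i hi).2) hn hω
  have hn0 : (0 : ℝ) < n := by rw [hn]; positivity
  have hkR : (8 : ℝ) ≤ k := by exact_mod_cast hk
  have hGR : (m : ℝ) ≤ 2 * G.card := by exact_mod_cast hGm
  -- With error at most `n / 32` the left factor is at least `n * (k / 4 - 1)`, and `8 ≤ k` makes
  -- this at least `n * k / 8`.
  have h2 : (n : ℝ) * (k / 8) ≤ n * ((k : ℝ) - 2) / 2 - 8 * k * (ε * (n * m : ℕ)) := by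
    push_cast
    have h3 : (n : ℝ) * k * (32 * (ε * m)) ≤ n * k * 1 :=
      mul_le_mul_of_nonneg_left hmε (by positivity)
    nlinarith
  have h4 := (mul_le_mul_of_nonneg_left h2 (Nat.cast_nonneg G.card)).trans h1
  have h5 : (G.card : ℝ) * (k / 8) ≤ s := by
    refine le_of_mul_le_mul_left ?_ hn0
    linarith
  nlinarith

end ZoomGame

/-! ### Choice of parameters -/

/-- For `δ` small enough a zooming depth proportional to `log log (1 / δ)` is affordable. -/
lemma exists_zoom_depth {δ : ℝ} (hδ : 0 < δ) (hδ₀ : δ ≤ Real.exp (-Real.exp 40)) :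
    ∃ k : ℕ, 8 ≤ k ∧ Real.log (Real.log (1 / δ)) ≤ 4 * k ∧
      4 * ((2 : ℝ) ^ (2 * (2 ^ k) ^ 2 + 2 ^ k) * δ) ≤ 1 := by
  set Λ := Real.log (1 / δ) with hΛ
  have hδΛ : δ = Real.exp (-Λ) := by
    rw [hΛ, one_div, Real.log_inv, neg_neg, Real.exp_log hδ]
  have hΛ40 : Real.exp 40 ≤ Λ := by
    rw [hδΛ, Real.exp_le_exp] at hδ₀
    linarith
  have hΛ0 : 0 < Λ := (Real.exp_pos _).trans_le hΛ40
  have hL40 : 40 ≤ Real.log Λ := (Real.le_log_iff_exp_le hΛ0).2 hΛ40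
  set L := Real.log Λ with hL
  have hfl := Nat.floor_le (show 0 ≤ L / 2 by linarith)
  have hfl' := Nat.lt_floor_add_one (L / 2)
  have h20 : 20 ≤ ⌊L / 2⌋₊ := Nat.le_floor (by push_cast; linarith)
  -- Taking one less than the floor absorbs the factor `4` in `4 * (2 ^ k) ^ 2 = 2 ^ (2 * (k + 1)) ≤
  -- exp L = Λ`.
  obtain ⟨k, hk⟩ : ∃ k, ⌊L / 2⌋₊ = k + 1 := ⟨⌊L / 2⌋₊ - 1, by omega⟩
  rw [hk] at hfl hfl' h20
  push_cast at hfl hfl'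
  refine ⟨k, by omega, by linarith, ?_⟩
  have hlog2 : Real.log 2 ≤ 1 := by
    have := Real.log_two_lt_d9; linarith
  have hpow : (4 : ℝ) * (2 ^ k) ^ 2 ≤ Λ := by
    have h1 : (4 : ℝ) * (2 ^ k) ^ 2 = Real.exp (2 * (k + 1) * Real.log 2) := by
      rw [show 2 * ((k : ℝ) + 1) * Real.log 2 = ((2 * (k + 1) : ℕ) : ℝ) * Real.log 2 by
        push_cast; ring, Real.exp_nat_mul, Real.exp_log (by norm_num)]
      ring
    rw [h1, ← Real.exp_log hΛ0, Real.exp_le_exp, ← hL]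
    have : 2 * ((k : ℝ) + 1) * Real.log 2 ≤ 2 * (k + 1) * 1 :=
      mul_le_mul_of_nonneg_left hlog2 (by positivity)
    linarith
  have hexp : 2 + (2 * (2 ^ k) ^ 2 + 2 ^ k) ≤ 4 * (2 ^ k) ^ 2 := by
    have : 2 ≤ 2 ^ k := by
      calc 2 = 2 ^ 1 := rfl
        _ ≤ 2 ^ k := Nat.pow_le_pow_right (by norm_num) (by omega)
    nlinarith
  calc 4 * ((2 : ℝ) ^ (2 * (2 ^ k) ^ 2 + 2 ^ k) * δ)
      = 2 ^ (2 + (2 * (2 ^ k) ^ 2 + 2 ^ k)) * δ := by rw [pow_add]; ring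
    _ ≤ 2 ^ (4 * (2 ^ k) ^ 2) * δ := by
        gcongr
        norm_num
    _ ≤ Real.exp 1 ^ (4 * (2 ^ k) ^ 2) * δ := by
        have : (2 : ℝ) ≤ Real.exp 1 := by
          have := Real.add_one_le_exp 1; linarith
        gcongr
    _ ≤ Real.exp Λ * δ := by
        rw [← Real.exp_nat_mul, mul_one]
        push_cast
        gcongr
    _ = 1 := by rw [hδΛ, ← Real.exp_add]; simp

theorem mainTheorem2 :
    ∃ c ε₀ δ₀ : ℝ, 0 < c ∧ 0 < ε₀ ∧ 0 < δ₀ ∧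
      ∀ (X : Type*) [LinearOrder X] [Infinite X]
        (Ω : Type*) [MeasurableSpace Ω] (P : Measure Ω) [IsProbabilityMeasure P]
        (M : Type*) (A : RandCmpAlg Ω M) (ε δ : ℝ),
        0 < ε → ε ≤ ε₀ → 0 < δ → δ ≤ δ₀ →
        SolvesSingleQuantile P X A ε δ →
        ∀ s : ℕ, StoresAtMost P X A s →
          c * ((1 / ε) * Real.log (Real.log (1 / δ))) ≤ (s : ℝ) := by
  -- `4096 = 64 * 4 * 16`: from `1 / ε ≤ 64 * m`, from `log log (1 / δ) ≤ 4 * k`, and from `m * k /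
  -- 16 ≤ s`. The bound on `ε` guarantees at least one block.
  refine ⟨1 / 4096, 1 / 32, Real.exp (-Real.exp 40), by norm_num, by norm_num,
    Real.exp_pos _, ?_⟩
  intro X _ _ Ω _ P _ M A ε δ hε hε₀ hδ hδ₀ hA s hs
  obtain ⟨k, hk, hkL, hsmall⟩ := exists_zoom_depth hδ hδ₀
  have hx : 1 ≤ 1 / (32 * ε) := by
    rw [le_div_iff₀ (by positivity)]; linarith
  have hfl := Nat.floor_le (show 0 ≤ 1 / (32 * ε) by linarith)
  have hfl' := Nat.lt_floor_add_one (1 / (32 * ε))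
  have hm : 1 ≤ ⌊1 / (32 * ε)⌋₊ := Nat.le_floor (by push_cast; exact hx)
  set m := ⌊1 / (32 * ε)⌋₊ with hmdef
  have hmε : 32 * (ε * m) ≤ 1 := by
    rw [le_div_iff₀ (by positivity)] at hfl
    linarith
  have h1 := ZoomGame.storage_ge P hA hs hm hmε hk hsmall
  have hmR : (1 : ℝ) ≤ m := by exact_mod_cast hm
  have h2 : 1 / ε ≤ 64 * m := by
    have : 1 / ε = 32 * (1 / (32 * ε)) := by field_simp
    rw [this]; linarith
  have h3 : 1 / ε * Real.log (Real.log (1 / δ)) ≤ 64 * m * (4 * k) := by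
    calc _ ≤ 1 / ε * (4 * k) := mul_le_mul_of_nonneg_left hkL (by positivity)
      _ ≤ _ := mul_le_mul_of_nonneg_right h2 (by positivity)
  linarith
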